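/- **Theorem (centralized $k$-priority push).** Let $P$ be a finite set of places (threads), each with a local priority queue and a local index $\mathrm{head}$. They share an unbounded array $\mathrm{global\_array}[0,1,2,\dots]$ of references to items, initially all null, and an integer $\mathrm{tail}$, initially $0$; an item has a creating place, a number $k$, a task, and a tag. Tasks are partially (pre)ordered by priority. Places execute the following operations in an arbitrary interleaving of atomic steps, each making at most one access to shared memory; an idle place may at any time invoke $\mathrm{push}(k,\mathit{task})$ with any $1\le k\le k_{\max}$, or $\mathrm{pop}$. * $\mathrm{push}(k,\mathit{task})$: create a new item $it$; then repeat: read $t:=\mathrm{tail}$; choose an arbitrary $o\in\{0,\dots,k-1\}$; for $i=o,\dots,o+k-1$ let $pos=t+(i \bmod k)$, write $it.\mathrm{tag}:=pos$ and try $\mathrm{CAS}(\mathrm{global\_array}[pos],\mathrm{null},it)$; on success, put a reference $(pos,it)$ into the local priority queue and return; if all $k$ attempts fail, do $\mathrm{CAS}(\mathrm{tail},t,t+k)$ and repeat. * $\mathrm{pop}$: while $\mathrm{head}<\mathrm{tail}$, put a reference to the item at $\mathrm{head}$ into the local priority queue if that item was created by another place, and increase $\mathrm{head}$; then remove a reference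 $(pos,it)$ of maximal priority from the local queue and try $\mathrm{CAS}(it.\mathrm{tag},pos,-1)$; on success return its task, on failure start over. If the local queue is empty, choose $o\in\{0,\dots,k_{\max}-1\}$, let $pos=\mathrm{tail}+o$, and if $pos$ holds an item $it$ whose number $k$ passes a fixed test against $o$ (any test), try $\mathrm{CAS}(it.\mathrm{tag},pos,-1)$; return its task on success, and null otherwise. Then: 1. ($\mathrm{push}$ is lock-free.) In every reachable configuration, a place that is executing a $\mathrm{push}$ can take its next step; and in every infinite execution (without any fairness assumption) in which infinitely many steps of $\mathrm{push}$ operations are taken, infinitely many $\mathrm{push}$ operations are completed. 2. ($\mathrm{push}$ is linearizable.) For every finite execution, the $\mathrm{push}$ operations whose CAS into $\mathrm{global\_array}$ has succeeded, ordered by these CAS steps, form a linearization of the $\mathrm{push}$ operations relative to each other. That is, every such operation performs exactly one such CAS, between its invocation and its response; every completed $\mathrm{push}$ is among them; if one $\mathrm{push}$ returns before another is invoked, it precedes it in the order; and the sequence is a legal sequential history leading from the empty array to the current contents of the array, where a sequential $\mathrm{push}(k,\mathit{task})$ puts its entry into a free slot $pos$ with $pos<f+k$, $f$ being the first free slot.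 The CAS puts the item, not yet taken, at $pos$, and a $\mathrm{pop}$ takes a task from a position only after the CAS of the $\mathrm{push}$ that put this task there. 3. (Placement.) At the moment of the successful CAS that puts an item with number $k$ at position $pos$, $\mathrm{tail}\le pos<\mathrm{tail}+k$. In particular each item is placed at most $k$ positions from $\mathrm{tail}$. -/

import Mathlib

namespace KPriority

universe u v

/-- The fields of an item that are fixed when it is created: the creating place, the relaxation
parameter `k` given with the task, and the task. -/
structure Entry (P : Type u) (Task : Type v) where
  place : P
  k : ℕ
  task : Task

/-- A reference to an item, as kept in the local priority queues: an index of the global array and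
the address of the item. -/
structure ItemRef where
  pos : ℕ
  it : ℕ

/-- Control states of a place, together with the values of the local variables that are live.
One transition leaves each state, and it makes at most one access to shared memory. -/
inductive PC (Task : Type v) where
  /-- no operation is running -/
  | idle
  /-- `Item it = new Item(place, k, task)` -/
  | pushNew (k : ℕ) (task : Task)
  /-- `int t = tail` -/
  | pushTail (k it : ℕ)
  /-- `int offset = rand(0, k - 1)` -/
  | pushRand (k it t : ℕ)
  /-- test of the `for` loop, followed by `it.tag = pos` or by `CAS(tail, t, t + k)` -/
  | pushLoop (k it t off i : ℕ)
  /-- `CAS(global_array[pos], null, it)` -/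
  | pushCas (k it t off i : ℕ)
  /-- `place.prio_queue.push(new ItemRef(pos, it))` -/
  | pushRef (pos it : ℕ)
  /-- `return` -/
  | pushRet
  /-- test `place.head < tail` -/
  | popCheck
  /-- look at `global_array[place.head]` and advance `place.head` -/
  | popItem
  /-- `ref = place.prio_queue.pop()` -/
  | popQueue
  /-- `Task task = ref.it.task` -/
  | popTask (r : ItemRef)
  /-- `CAS(ref.it.tag, ref.tag, -1)` -/
  | popCas (r : ItemRef) (task : Task)
  /-- `int offset = rand(0, kMax - 1)` -/
  | popRand
  /-- read `tail` -/
  | popTail (off : ℕ)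
  /-- test `global_array[tail + offset] != null` -/
  | popProbe (off pos : ℕ)
  /-- test of the `k` of the item found, then `Task task = it.task` -/
  | popRead (off pos it : ℕ)
  /-- `CAS(it.tag, tail + offset, -1)` -/
  | popTake (pos it : ℕ) (task : Task)
  /-- `return res` -/
  | popRet (res : Option Task)

/-- The control states inside a `push` operation, from its invocation to its response. -/
def PC.InPush {Task : Type v} : PC Task → Prop
  | .pushNew _ _ => True
  | .pushTail _ _ => True
  | .pushRand _ _ _ => True
  | .pushLoop _ _ _ _ _ => True
  | .pushCas _ _ _ _ _ => True
  | .pushRef _ _ => True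
  | .pushRet => True
  | _ => False

/-- A configuration: shared memory, the local component of every place, and control states. -/
structure Config (P : Type u) (Task : Type v) where
  /-- the unbounded global array; `none` is `null`, `some a` is the item at address `a` -/
  array : ℕ → Option ℕ
  tail : ℕ
  /-- the items, by address; `none` means not allocated -/
  item : ℕ → Option (Entry P Task)
  /-- the tag field of the item at an address; `-1` means taken -/
  tag : ℕ → ℤ
  /-- the local priority queues -/
  queue : P → Multiset ItemRef
  head : P → ℕ
  pc : P → PC Task

/-- The observable part of a transition. -/
inductive Act (Task : Type v) where
  /-- invocation of `push` -/
  | invPush (k : ℕ) (task : Task)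
  /-- response of `push` -/
  | resPush
  /-- invocation of `pop` -/
  | invPop
  /-- response of `pop` -/
  | resPop (res : Option Task)
  /-- a successful `CAS(global_array[pos], null, it)` -/
  | insert (pos : ℕ)
  /-- a successful CAS of `pop` that takes the item of position `pos`, which carries `task` -/
  | take (pos : ℕ) (task : Task)
  /-- any other step -/
  | internal

/-- The place that makes a transition, and the observable part of that transition. -/
structure Label (P : Type u) (Task : Type v) where
  place : P
  act : Act Task

/-- The initial configuration: empty data structure, every place idle. -/
def initial (P : Type u) (Task : Type v) : Config P Task where
  array := fun _ => none
  tail := 0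
  item := fun _ => none
  tag := fun _ => -1
  queue := fun _ => 0
  head := fun _ => 0
  pc := fun _ => .idle

/-- Move place `p` to control state `c`. -/
def Config.goto {P : Type u} {Task : Type v} [DecidableEq P]
    (s : Config P Task) (p : P) (c : PC Task) : Config P Task :=
  { s with pc := Function.update s.pc p c }

/-- The transitions of the data structure. The client is unrestricted: an idle place may
invoke `push` with any task and any `1 ≤ k ≤ kMax`, or `pop`, at any moment.
In the preorder on tasks larger means higher priority.
The parameter `test k offset` is the comparison which `pop` makes of the `k` of an item beyond
`tail` with its offset. -/
inductive Step {P : Type u} {Task : Type v} [DecidableEq P] [Preorder Task]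
    (kMax : ℕ) (test : ℕ → ℕ → Prop) :
    Config P Task → Label P Task → Config P Task → Prop
  -- push
  | invPush (s : Config P Task) (p : P) (k : ℕ) (task : Task)
      (hpc : s.pc p = .idle) (hk : 1 ≤ k) (hk' : k ≤ kMax) :
      Step kMax test s ⟨p, .invPush k task⟩ (s.goto p (.pushNew k task))
  | pushNew (s : Config P Task) (p : P) (k : ℕ) (task : Task) (a : ℕ) (v : ℤ)
      (hpc : s.pc p = .pushNew k task) (hfresh : s.item a = none) :
      Step kMax test s ⟨p, .internal⟩
        ({ s with item := Function.update s.item a (some ⟨p, k, task⟩)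
                  tag := Function.update s.tag a v }.goto p (.pushTail k a))
  | pushTail (s : Config P Task) (p : P) (k it : ℕ)
      (hpc : s.pc p = .pushTail k it) :
      Step kMax test s ⟨p, .internal⟩ (s.goto p (.pushRand k it s.tail))
  | pushRand (s : Config P Task) (p : P) (k it t off : ℕ)
      (hpc : s.pc p = .pushRand k it t) (hoff : off < k) :
      Step kMax test s ⟨p, .internal⟩ (s.goto p (.pushLoop k it t off off))
  | pushTag (s : Config P Task) (p : P) (k it t off i : ℕ)
      (hpc : s.pc p = .pushLoop k it t off i) (hi : i < off + k) :
      Step kMax test s ⟨p, .internal⟩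
        ({ s with tag := Function.update s.tag it ((t + i % k : ℕ) : ℤ) }.goto p
          (.pushCas k it t off i))
  | pushCasSucc (s : Config P Task) (p : P) (k it t off i : ℕ)
      (hpc : s.pc p = .pushCas k it t off i) (hfree : s.array (t + i % k) = none) :
      Step kMax test s ⟨p, .insert (t + i % k)⟩
        ({ s with array := Function.update s.array (t + i % k) (some it) }.goto p
          (.pushRef (t + i % k) it))
  | pushCasFail (s : Config P Task) (p : P) (k it t off i : ℕ)
      (hpc : s.pc p = .pushCas k it t off i) (hfull : s.array (t + i % k) ≠ none) :
      Step kMax test s ⟨p, .internal⟩ (s.goto p (.pushLoop k it t off (i + 1)))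
  | pushTailSucc (s : Config P Task) (p : P) (k it t off i : ℕ)
      (hpc : s.pc p = .pushLoop k it t off i) (hi : off + k ≤ i) (ht : s.tail = t) :
      Step kMax test s ⟨p, .internal⟩ ({ s with tail := t + k }.goto p (.pushTail k it))
  | pushTailFail (s : Config P Task) (p : P) (k it t off i : ℕ)
      (hpc : s.pc p = .pushLoop k it t off i) (hi : off + k ≤ i) (ht : s.tail ≠ t) :
      Step kMax test s ⟨p, .internal⟩ (s.goto p (.pushTail k it))
  | pushRef (s : Config P Task) (p : P) (pos it : ℕ)
      (hpc : s.pc p = .pushRef pos it) :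
      Step kMax test s ⟨p, .internal⟩
        ({ s with queue := Function.update s.queue p (⟨pos, it⟩ ::ₘ s.queue p) }.goto p .pushRet)
  | resPush (s : Config P Task) (p : P) (hpc : s.pc p = .pushRet) :
      Step kMax test s ⟨p, .resPush⟩ (s.goto p .idle)
  -- pop
  | invPop (s : Config P Task) (p : P) (hpc : s.pc p = .idle) :
      Step kMax test s ⟨p, .invPop⟩ (s.goto p .popCheck)
  | popCheckMore (s : Config P Task) (p : P)
      (hpc : s.pc p = .popCheck) (h : s.head p < s.tail) :
      Step kMax test s ⟨p, .internal⟩ (s.goto p .popItem)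
  | popCheckDone (s : Config P Task) (p : P)
      (hpc : s.pc p = .popCheck) (h : s.tail ≤ s.head p) :
      Step kMax test s ⟨p, .internal⟩ (s.goto p .popQueue)
  | popItemOther (s : Config P Task) (p : P) (it : ℕ) (e : Entry P Task)
      (hpc : s.pc p = .popItem) (ha : s.array (s.head p) = some it) (he : s.item it = some e)
      (hp : e.place ≠ p) :
      Step kMax test s ⟨p, .internal⟩
        ({ s with queue := Function.update s.queue p (⟨s.head p, it⟩ ::ₘ s.queue p)
                  head := Function.update s.head p (s.head p + 1) }.goto p .popCheck)
  | popItemOwn (s : Config P Task) (p : P) (it : ℕ) (e : Entry P Task)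
      (hpc : s.pc p = .popItem) (ha : s.array (s.head p) = some it) (he : s.item it = some e)
      (hp : e.place = p) :
      Step kMax test s ⟨p, .internal⟩
        ({ s with head := Function.update s.head p (s.head p + 1) }.goto p .popCheck)
  | popQueueSome (s : Config P Task) (p : P) (r : ItemRef) (q : Multiset ItemRef)
      (hpc : s.pc p = .popQueue) (hq : s.queue p = r ::ₘ q)
      (hmax : ∀ r' ∈ q, ∀ e e', s.item r.it = some e → s.item r'.it = some e' →
        ¬ e.task < e'.task) :
      Step kMax test s ⟨p, .internal⟩
        ({ s with queue := Function.update s.queue p q }.goto p (.popTask r))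
  | popQueueEmpty (s : Config P Task) (p : P)
      (hpc : s.pc p = .popQueue) (hq : s.queue p = 0) :
      Step kMax test s ⟨p, .internal⟩ (s.goto p .popRand)
  | popTask (s : Config P Task) (p : P) (r : ItemRef) (e : Entry P Task)
      (hpc : s.pc p = .popTask r) (he : s.item r.it = some e) :
      Step kMax test s ⟨p, .internal⟩ (s.goto p (.popCas r e.task))
  | popCasSucc (s : Config P Task) (p : P) (r : ItemRef) (task : Task)
      (hpc : s.pc p = .popCas r task) (ht : s.tag r.it = (r.pos : ℤ)) :
      Step kMax test s ⟨p, .take r.pos task⟩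
        ({ s with tag := Function.update s.tag r.it (-1) }.goto p (.popRet (some task)))
  | popCasFail (s : Config P Task) (p : P) (r : ItemRef) (task : Task)
      (hpc : s.pc p = .popCas r task) (ht : s.tag r.it ≠ (r.pos : ℤ)) :
      Step kMax test s ⟨p, .internal⟩ (s.goto p .popCheck)
  | popRand (s : Config P Task) (p : P) (off : ℕ)
      (hpc : s.pc p = .popRand) (hoff : off < kMax) :
      Step kMax test s ⟨p, .internal⟩ (s.goto p (.popTail off))
  | popTail (s : Config P Task) (p : P) (off : ℕ)
      (hpc : s.pc p = .popTail off) :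
      Step kMax test s ⟨p, .internal⟩ (s.goto p (.popProbe off (s.tail + off)))
  | popProbeNull (s : Config P Task) (p : P) (off pos : ℕ)
      (hpc : s.pc p = .popProbe off pos) (ha : s.array pos = none) :
      Step kMax test s ⟨p, .internal⟩ (s.goto p (.popRet none))
  | popProbeItem (s : Config P Task) (p : P) (off pos it : ℕ)
      (hpc : s.pc p = .popProbe off pos) (ha : s.array pos = some it) :
      Step kMax test s ⟨p, .internal⟩ (s.goto p (.popRead off pos it))
  | popReadPass (s : Config P Task) (p : P) (off pos it : ℕ) (e : Entry P Task)
      (hpc : s.pc p = .popRead off pos it) (he : s.item it = some e) (ht : test e.k off) :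
      Step kMax test s ⟨p, .internal⟩ (s.goto p (.popTake pos it e.task))
  | popReadStop (s : Config P Task) (p : P) (off pos it : ℕ) (e : Entry P Task)
      (hpc : s.pc p = .popRead off pos it) (he : s.item it = some e) (ht : ¬ test e.k off) :
      Step kMax test s ⟨p, .internal⟩ (s.goto p (.popRet none))
  | popTakeSucc (s : Config P Task) (p : P) (pos it : ℕ) (task : Task)
      (hpc : s.pc p = .popTake pos it task) (ht : s.tag it = (pos : ℤ)) :
      Step kMax test s ⟨p, .take pos task⟩
        ({ s with tag := Function.update s.tag it (-1) }.goto p (.popRet (some task)))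
  | popTakeFail (s : Config P Task) (p : P) (pos it : ℕ) (task : Task)
      (hpc : s.pc p = .popTake pos it task) (ht : s.tag it ≠ (pos : ℤ)) :
      Step kMax test s ⟨p, .internal⟩ (s.goto p (.popRet none))
  | resPop (s : Config P Task) (p : P) (res : Option Task)
      (hpc : s.pc p = .popRet res) :
      Step kMax test s ⟨p, .resPop res⟩ (s.goto p .idle)

section Executions

variable {P : Type u} {Task : Type v} [DecidableEq P] [Preorder Task]

/-- The first `N` steps of `(st, lab)` form an execution: an arbitrary interleaving of steps of the
places, from the initial configuration. Step `n` leads from `st n` to `st (n + 1)`. -/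
def IsExec (kMax : ℕ) (test : ℕ → ℕ → Prop) (N : ℕ)
    (st : ℕ → Config P Task) (lab : ℕ → Label P Task) : Prop :=
  st 0 = initial P Task ∧ ∀ n < N, Step kMax test (st n) (lab n) (st (n + 1))

/-- `push` is lock-free: in every reachable configuration a place inside a `push` is able to take
its next step, whatever the other places do (no blocking); and in every infinite execution, with no
fairness assumption, in which steps of `push` operations are taken infinitely often, `push`
operations are completed infinitely often. -/
def PushLockFree (P : Type u) (Task : Type v) [DecidableEq P] [Preorder Task]
    (kMax : ℕ) (test : ℕ → ℕ → Prop) : Prop :=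
  (∀ (N : ℕ) (st : ℕ → Config P Task) (lab : ℕ → Label P Task), IsExec kMax test N st lab →
    ∀ p : P, ((st N).pc p).InPush →
      ∃ (a : Act Task) (s' : Config P Task), Step kMax test (st N) ⟨p, a⟩ s') ∧
  (∀ (st : ℕ → Config P Task) (lab : ℕ → Label P Task), (∀ N, IsExec kMax test N st lab) →
    (∀ m : ℕ, ∃ n ≥ m, ((st n).pc (lab n).place).InPush) →
    ∀ m : ℕ, ∃ n ≥ m, (lab n).act = .resPush)

/-- Sequential specification of `push`, on the sequence of slots: the new entry goes
into a free slot less than `k` positions after the first free slot. -/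
def SeqPush (A : ℕ → Option (Entry P Task)) (e : Entry P Task) (pos : ℕ)
    (A' : ℕ → Option (Entry P Task)) : Prop :=
  A pos = none ∧ (∃ f, IsLeast {j | A j = none} f ∧ pos < f + e.k) ∧
    A' = Function.update A pos (some e)

/-- A `push` in a sequential history: the call (named by the time of its invocation), its entry, and
the position that its entry gets. -/
structure PushOp (P : Type u) (Task : Type v) where
  call : ℕ
  entry : Entry P Task
  pos : ℕ

/-- Legal sequential histories, from a state to a state. -/
inductive SeqHistory : (ℕ → Option (Entry P Task)) → List (PushOp P Task) →
    (ℕ → Option (Entry P Task)) → Prop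
  | nil (A : ℕ → Option (Entry P Task)) : SeqHistory A [] A
  | cons (A B C : ℕ → Option (Entry P Task)) (o : PushOp P Task) (l : List (PushOp P Task))
      (ho : SeqPush A o.entry o.pos B) (hl : SeqHistory B l C) : SeqHistory A (o :: l) C

/-- The abstract state of a configuration: which entry each slot of the global array holds. -/
def Config.slots (s : Config P Task) : ℕ → Option (Entry P Task) :=
  fun j => (s.array j).bind s.item

/-- The step at time `c` lies within the `push` call that is invoked at time `i` by the place `p`:
it comes later than the invocation and not later than the response. -/
def During (lab : ℕ → Label P Task) (p : P) (i c : ℕ) : Prop :=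
  i < c ∧ ∀ m, i < m → m < c → lab m ≠ ⟨p, .resPush⟩

/-- The `push` call invoked at time `i` by the place `p` returns at time `j`. -/
def Returns (lab : ℕ → Label P Task) (p : P) (i j : ℕ) : Prop :=
  During lab p i j ∧ lab j = ⟨p, .resPush⟩

/-- `L` is a linearization of the `push` operations in the first `N` steps: it is made of `push`
calls, each at most once; it has every completed call and maybe some pending ones; if a call returns
before another one is invoked, then it does not come after that one; and it is a legal sequential
history from the empty state to the state that is reached. -/
structure IsLinearization (N : ℕ) (st : ℕ → Config P Task) (lab : ℕ → Label P Task)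
    (L : List (PushOp P Task)) : Prop where
  isCall : ∀ o ∈ L, o.call < N ∧ lab o.call = ⟨o.entry.place, .invPush o.entry.k o.entry.task⟩
  nodup : (L.map PushOp.call).Nodup
  complete : ∀ i j p k task, j < N → lab i = ⟨p, .invPush k task⟩ → Returns lab p i j →
    ∃ o ∈ L, o.call = i
  realTime : L.Pairwise fun a b => ¬ ∃ j, Returns lab b.entry.place b.call j ∧ j < a.call
  legal : SeqHistory (fun _ => none) L (st N).slots

/-- The operations `L` take effect, in this order, at the successful CAS steps on the global array:
the `n`-th member of `L` at the `n`-th of these steps, which lies within the call, puts an item that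
is not taken at the position `pos`, and finds `tail ≤ pos < tail + k`. -/
def LinearizedAtCAS (N : ℕ) (st : ℕ → Config P Task) (lab : ℕ → Label P Task)
    (L : List (PushOp P Task)) : Prop :=
  ∃ cs : List ℕ, cs.Pairwise (· < ·) ∧
    (∀ c, c ∈ cs ↔ c < N ∧ ∃ pos, (lab c).act = .insert pos) ∧
    List.Forall₂ (fun (o : PushOp P Task) (c : ℕ) =>
      During lab o.entry.place o.call c ∧
      lab c = ⟨o.entry.place, .insert o.pos⟩ ∧
      (∃ it, (st (c + 1)).array o.pos = some it ∧ (st (c + 1)).item it = some o.entry ∧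
        (st (c + 1)).tag it = (o.pos : ℤ)) ∧
      (st c).tail ≤ o.pos ∧ o.pos < (st c).tail + o.entry.k) L cs

/-- A `pop` takes a task only after the successful CAS of the `push` of that task. -/
def TakenAfterCAS (N : ℕ) (lab : ℕ → Label P Task) (L : List (PushOp P Task)) : Prop :=
  ∀ d < N, ∀ p pos task, lab d = ⟨p, .take pos task⟩ →
    ∃ o ∈ L, o.pos = pos ∧ o.entry.task = task ∧
      ∃ c < d, During lab o.entry.place o.call c ∧ lab c = ⟨o.entry.place, .insert pos⟩

end Executions

end KPriority

/-! A global invariant and two progress measures carry everything. Array slots are never cleared (a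
`pop` only overwrites a tag), `tail` never decreases, and every slot below `tail` is occupied,
because a `push` advances `tail` from `t` to `t + k` only after its `k` failed attempts have met an
occupied slot at each of `t, ..., t + k - 1`. These facts belong to `Inv`, which `Inv.step`
preserves by a rely-guarantee argument: `Extends` bounds what one place can do to the others.

Placement follows: a successful CAS hits a free slot, hence one at or above `tail`; and it lies
below `t + k`, where `t` is an earlier value of `tail`, hence at most the current one. The first
free slot is also at or above `tail`, so the insertion is legal for the sequential specification.
`Inv.effect` records this for each transition, and `IsExec.exists_tracks` builds the linearization
by appending one call per successful CAS.

For lock-freedom, suppose that no `push` completes from some time on. The total number of remaining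
phases, finite since there are finitely many places, stops decreasing, and from then on nothing is
inserted. The array is then constant with finitely many occupied slots, so `tail` is bounded and
stabilizes too. Now each further step of a `push` uses up a retry (`Inv.stalled`), so only finitely
many such steps can follow. -/

namespace KPriority

universe u v

/-! ### The invariant of reachable configurations and non-interference between places. -/

section Invariant

variable {P : Type u} {Task : Type v}

/-- The place `p` is pushing the item at address `a`, which is not in the array yet. -/
def Owns (s : Config P Task) (p : P) (k a : ℕ) : Prop :=
  1 ≤ k ∧ (∃ task, s.item a = some ⟨p, k, task⟩) ∧ ∀ j, s.array j ≠ some a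

/-- The slots tried by a `push` before attempt `i` are occupied. -/
def Tried (s : Config P Task) (k t off i : ℕ) : Prop :=
  t ≤ s.tail ∧ off < k ∧ ∀ j, off ≤ j → j < i → s.array (t + j % k) ≠ none

/-- What holds when the place `p` is in a given control state. -/
def PCInv (s : Config P Task) (p : P) : PC Task → Prop
  | .pushNew k _ => 1 ≤ k
  | .pushTail k it => Owns s p k it
  | .pushRand k it t => Owns s p k it ∧ t ≤ s.tail
  | .pushLoop k it t off i => Owns s p k it ∧ Tried s k t off i
  | .pushCas k it t off i => Owns s p k it ∧ Tried s k t off i ∧ i < off + k ∧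
      s.tag it = ((t + i % k : ℕ) : ℤ)
  | .pushRef pos it => s.array pos = some it
  | .popTask r => s.array r.pos = some r.it
  | .popCas r task => s.array r.pos = some r.it ∧ ∃ e, s.item r.it = some e ∧ e.task = task
  | .popRead _ pos it => s.array pos = some it
  | .popTake pos it task => s.array pos = some it ∧ ∃ e, s.item it = some e ∧ e.task = task
  | _ => True

/-- The invariant of reachable configurations. -/
structure Inv (s : Config P Task) : Prop where
  filled : ∀ j < s.tail, s.array j ≠ none
  alloc : ∀ j a, s.array j = some a → ∃ e, s.item a = some e
  item_bdd : ∃ B, ∀ a ≥ B, s.item a = none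
  array_bdd : ∃ B, ∀ j ≥ B, s.array j = none
  queue : ∀ p, ∀ r ∈ s.queue p, s.array r.pos = some r.it
  pc : ∀ p, PCInv s p (s.pc p)

/-- The part of a step of the place `p` that other places can observe. -/
structure Extends (p : P) (s s' : Config P Task) : Prop where
  array : ∀ j a, s.array j = some a → s'.array j = some a
  item : ∀ a e, s.item a = some e → s'.item a = some e
  tail : s.tail ≤ s'.tail
  new : ∀ j a, s'.array j = some a →
    s.array j = some a ∨ ∃ e, s.item a = some e ∧ e.place = p
  tag : ∀ a e, s.item a = some e → e.place ≠ p → (∀ j, s.array j ≠ some a) → s'.tag a = s.tag a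
  pc : ∀ q, q ≠ p → s'.pc q = s.pc q
  queue : ∀ q, q ≠ p → s'.queue q = s.queue q

theorem Extends.array_ne_none {p : P} {s s' : Config P Task} (h : Extends p s s') {j : ℕ}
    (hj : s.array j ≠ none) : s'.array j ≠ none := by
  obtain ⟨a, ha⟩ := Option.ne_none_iff_exists'.1 hj
  simp [h.array j a ha]

theorem Extends.tried {p : P} {s s' : Config P Task} (h : Extends p s s') {k t off i : ℕ}
    (ht : Tried s k t off i) : Tried s' k t off i :=
  ⟨ht.1.trans h.tail, ht.2.1, fun j h1 h2 => h.array_ne_none (ht.2.2 j h1 h2)⟩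

/-- A place inserts only items that it created itself, so it cannot publish an item that another
place is still pushing. -/
theorem Extends.owns {p q : P} {s s' : Config P Task} (h : Extends p s s') (hq : q ≠ p)
    {k a : ℕ} (ho : Owns s q k a) : Owns s' q k a := by
  obtain ⟨hk, ⟨task, ht⟩, hj⟩ := ho
  refine ⟨hk, ⟨task, h.item _ _ ht⟩, fun j hja => ?_⟩
  rcases h.new j a hja with h1 | ⟨e, he, hp⟩
  · exact hj j h1
  · rw [ht] at he
    cases he
    exact hq hp

/-- Non-interference. The delicate state is `pushCas`, whose assertion mentions a tag in shared
memory: it is stable because the item is neither created by `p` nor yet in the array. -/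
theorem Extends.pcInv {p q : P} {s s' : Config P Task} (h : Extends p s s') (hq : q ≠ p)
    {c : PC Task} (hc : PCInv s q c) : PCInv s' q c := by
  cases c with
  | idle | pushRet | popCheck | popItem | popQueue | popRand | popTail | popProbe | popRet =>
    trivial
  | pushNew => exact hc
  | pushTail => exact h.owns hq hc
  | pushRand => exact ⟨h.owns hq hc.1, hc.2.trans h.tail⟩
  | pushLoop => exact ⟨h.owns hq hc.1, h.tried hc.2⟩
  | pushCas k it =>
    obtain ⟨ho, ht, hi, hg⟩ := hc
    obtain ⟨task, he⟩ := ho.2.1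
    exact ⟨h.owns hq ho, h.tried ht, hi, (h.tag it _ he hq ho.2.2).trans hg⟩
  | pushRef | popTask | popRead => exact h.array _ _ hc
  | popCas | popTake =>
    obtain ⟨ha, e, he, hk⟩ := hc
    exact ⟨h.array _ _ ha, e, h.item _ _ he, hk⟩

/-- The indices `off, ..., off + k - 1` run through all residues modulo `k`; a residue `j < off` is
met as `j + k`, after the wrap-around. -/
theorem Tried.array_ne_none {s : Config P Task} {k t off i : ℕ} (h : Tried s k t off i)
    (hi : off + k ≤ i) {j : ℕ} (hj : j < k) : s.array (t + j) ≠ none := by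
  obtain ⟨-, ho, h⟩ := h
  by_cases hoj : off ≤ j
  · simpa [Nat.mod_eq_of_lt hj] using h j hoj (by omega)
  · simpa [Nat.mod_eq_of_lt hj] using h (j + k) (by omega) (by omega)

theorem inv_initial : Inv (initial P Task) :=
  ⟨fun j hj => absurd hj (Nat.not_lt_zero j), fun _ _ h => by simp [initial] at h,
    ⟨0, fun _ _ => rfl⟩, ⟨0, fun _ _ => rfl⟩, fun p r hr => by simp [initial] at hr,
    fun _ => trivial⟩

variable [DecidableEq P] [Preorder Task] {kMax : ℕ} {test : ℕ → ℕ → Prop}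

/-- The guarantee side. Tags are written in three ways: on allocation, to a fresh address; by a
`push`, to its own item; by a `pop`, to an item that the invariant locates in the array. None of
these touches the unpublished item of another place. -/
theorem Inv.extends {s s' : Config P Task} {l : Label P Task} (hs : Inv s)
    (h : Step kMax test s l s') : Extends l.place s s' := by
  have hp := hs.pc l.place
  cases h
  case pushNew p k task a v hpc hfresh =>
    refine ⟨fun _ _ h => h, fun b e hb => ?_, le_rfl, fun _ _ h => .inl h, fun b e hb _ _ => ?_,
      fun q hq => by simp [Config.goto, hq], fun q hq => rfl⟩
    all_goals
      have : b ≠ a := by rintro rfl; simp [hfresh] at hb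
      simp [Config.goto, this, hb]
  case pushTag p k it t off i hpc hi =>
    rw [hpc] at hp
    obtain ⟨task, he⟩ := hp.1.2.1
    refine ⟨fun _ _ h => h, fun _ _ h => h, le_rfl, fun _ _ h => .inl h, fun b e hb hne _ => ?_,
      fun q hq => by simp [Config.goto, hq], fun q hq => rfl⟩
    have : b ≠ it := by
      rintro rfl
      rw [he] at hb
      cases hb
      exact hne rfl
    simp [Config.goto, this]
  case pushCasSucc p k it t off i hpc hfree =>
    rw [hpc] at hp
    obtain ⟨task, he⟩ := hp.1.2.1
    refine ⟨fun j a h => ?_, fun _ _ h => h, le_rfl, fun j a h => ?_, fun _ _ _ _ _ => rfl,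
      fun q hq => by simp [Config.goto, hq], fun q hq => rfl⟩
    · have : j ≠ t + i % k := by rintro rfl; simp [hfree] at h
      simp [Config.goto, this, h]
    · by_cases hj : j = t + i % k
      · subst hj
        simp [Config.goto] at h
        subst h
        exact .inr ⟨_, he, rfl⟩
      · simp [Config.goto, hj] at h
        exact .inl h
  case pushTailSucc p k it t off i hpc hi ht =>
    exact ⟨fun _ _ h => h, fun _ _ h => h, by simp [Config.goto, ht], fun _ _ h => .inl h,
      fun _ _ _ _ _ => rfl, fun q hq => by simp [Config.goto, hq], fun q hq => rfl⟩
  case popCasSucc p r task hpc ht =>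
    rw [hpc] at hp
    refine ⟨fun _ _ h => h, fun _ _ h => h, le_rfl, fun _ _ h => .inl h, fun b e hb hne hb' => ?_,
      fun q hq => by simp [Config.goto, hq], fun q hq => rfl⟩
    have : b ≠ r.it := fun h => hb' _ (h ▸ hp.1)
    simp [Config.goto, this]
  case popTakeSucc p pos it task hpc ht =>
    rw [hpc] at hp
    refine ⟨fun _ _ h => h, fun _ _ h => h, le_rfl, fun _ _ h => .inl h, fun b e hb hne hb' => ?_,
      fun q hq => by simp [Config.goto, hq], fun q hq => rfl⟩
    have : b ≠ it := fun h => hb' _ (h ▸ hp.1)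
    simp [Config.goto, this]
  all_goals
    exact ⟨fun _ _ h => h, fun _ _ h => h, le_rfl, fun _ _ h => .inl h, fun _ _ _ _ _ => rfl,
      fun q hq => by simp [Config.goto, hq], fun q hq => by simp [Config.goto, hq]⟩

theorem Inv.step {s s' : Config P Task} {l : Label P Task} (hs : Inv s)
    (h : Step kMax test s l s') : Inv s' := by
  have hx := hs.extends h
  -- `Extends` transports all older facts, including those of the other places. What is left
  -- concerns the slots that `tail` has just passed, the two finiteness bounds, and the queue and
  -- control state of the acting place.
  suffices hmain : (∀ j, s.tail ≤ j → j < s'.tail → s.array j ≠ none) ∧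
      (∃ B, ∀ a ≥ B, s'.item a = none) ∧ (∃ B, ∀ j ≥ B, s'.array j = none) ∧
      (∀ r ∈ s'.queue l.place, s'.array r.pos = some r.it) ∧
      PCInv s' l.place (s'.pc l.place) by
    obtain ⟨h1, h2, h3, h4, h5⟩ := hmain
    refine ⟨fun j hj => hx.array_ne_none ?_, fun j a ha => ?_, h2, h3, fun q r hr => ?_,
      fun q => ?_⟩
    · rcases lt_or_ge j s.tail with hlt | hge
      · exact hs.filled j hlt
      · exact h1 j hge hj
    · rcases hx.new j a ha with hb | ⟨e, he, -⟩
      · obtain ⟨e, he⟩ := hs.alloc j a hb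
        exact ⟨e, hx.item _ _ he⟩
      · exact ⟨e, hx.item _ _ he⟩
    · by_cases hq : q = l.place
      · exact h4 r (hq ▸ hr)
      · rw [hx.queue q hq] at hr
        exact hx.array _ _ (hs.queue q r hr)
    · by_cases hq : q = l.place
      · exact hq ▸ h5
      · rw [hx.pc q hq]
        exact hx.pcInv hq (hs.pc q)
  have hp := hs.pc l.place
  have hQ := hs.queue l.place
  obtain ⟨Bi, hBi⟩ := hs.item_bdd
  obtain ⟨Ba, hBa⟩ := hs.array_bdd
  cases h
  case pushNew p k task a v hpc hfresh =>
    rw [hpc] at hp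
    refine ⟨fun j h1 h2 => absurd h2 (not_lt.2 h1), ⟨max Bi (a + 1), fun b hb => ?_⟩, ⟨Ba, hBa⟩,
      hQ, ?_⟩
    · have : b ≠ a := by rintro rfl; omega
      simp [Config.goto, this, hBi b (by omega)]
    · simp only [Config.goto, Function.update_self]
      refine ⟨hp, ⟨task, by simp⟩, fun j hj => ?_⟩
      obtain ⟨e, he⟩ := hs.alloc j a hj
      simp [hfresh] at he
  case pushCasSucc p k it t off i hpc hfree =>
    rw [hpc] at hp
    refine ⟨fun j h1 h2 => absurd h2 (not_lt.2 h1), ⟨Bi, hBi⟩,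
      ⟨max Ba (t + i % k + 1), fun j hj => ?_⟩, fun r hr => hx.array _ _ (hQ r hr), ?_⟩
    · have : j ≠ t + i % k := by rintro rfl; omega
      simp [Config.goto, this, hBa j (by omega)]
    · simp [Config.goto, PCInv]
  case pushTailSucc p k it t off i hpc hi ht =>
    rw [hpc] at hp
    refine ⟨fun j h1 h2 => ?_, ⟨Bi, hBi⟩, ⟨Ba, hBa⟩, hQ, ?_⟩
    -- The slots passed by `tail` are exactly the `k` slots that the finished loop found occupied.
    · obtain ⟨d, rfl⟩ := Nat.exists_eq_add_of_le h1
      rw [ht] at h2 ⊢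
      exact hp.2.array_ne_none hi (by simpa [Config.goto] using h2)
    · simp only [Config.goto, Function.update_self]
      exact hp.1
  all_goals refine ⟨fun j h1 h2 => absurd h2 (not_lt.2 h1), ⟨Bi, hBi⟩, ⟨Ba, hBa⟩, ?_, ?_⟩
  all_goals try exact hQ
  all_goals try simp only [Config.goto, Function.update_self]
  case pushRef.refine_1 p pos it hpc =>
    rw [hpc] at hp
    intro r hr
    rcases Multiset.mem_cons.1 hr with rfl | hr
    · exact hp
    · exact hQ r hr
  case popItemOther.refine_1 p it e hpc ha he hne =>
    intro r hr
    rcases Multiset.mem_cons.1 hr with rfl | hr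
    · exact ha
    · exact hQ r hr
  case popQueueSome.refine_1 p r q hpc hq hmax =>
    intro r' hr
    exact hQ r' (hq ▸ Multiset.mem_cons_of_mem hr)
  case popQueueSome.refine_2 p r q hpc hq hmax =>
    exact hQ r (hq ▸ Multiset.mem_cons_self r q)
  case pushTail.refine_2 p k it hpc =>
    rw [hpc] at hp
    exact ⟨hp, le_rfl⟩
  case pushRand.refine_2 p k it t off hpc hoff =>
    rw [hpc] at hp
    exact ⟨hp.1, hp.2, hoff, fun j h1 h2 => absurd h2 (not_lt.2 h1)⟩
  case pushTag.refine_2 p k it t off i hpc hi =>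
    rw [hpc] at hp
    exact ⟨hp.1, hp.2, hi, by simp⟩
  case pushCasFail.refine_2 p k it t off i hpc hfull =>
    rw [hpc] at hp
    refine ⟨hp.1, hp.2.1.1, hp.2.1.2.1, fun j h1 h2 => ?_⟩
    rcases Nat.lt_succ_iff_lt_or_eq.1 h2 with h2 | rfl
    · exact hp.2.1.2.2 j h1 h2
    · exact hfull
  case popTask.refine_2 p r e hpc he =>
    rw [hpc] at hp
    exact ⟨hp, e, he, rfl⟩
  case popReadPass.refine_2 p off pos it e hpc he ht =>
    rw [hpc] at hp
    exact ⟨hp, e, he, rfl⟩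
  all_goals
    first
    | trivial
    | assumption
    | (rw [‹s.pc _ = _›] at hp; exact hp.1)

theorem IsExec.mono {M N : ℕ} {st : ℕ → Config P Task} {lab : ℕ → Label P Task}
    (h : IsExec kMax test N st lab) (hM : M ≤ N) : IsExec kMax test M st lab :=
  ⟨h.1, fun n hn => h.2 n (hn.trans_le hM)⟩

theorem IsExec.inv {N : ℕ} {st : ℕ → Config P Task} {lab : ℕ → Label P Task}
    (h : IsExec kMax test N st lab) : Inv (st N) := by
  induction N with
  | zero => exact h.1 ▸ inv_initial
  | succ N ih => exact (ih (h.mono N.le_succ)).step (h.2 N N.lt_succ_self)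

end Invariant

/-! ### Construction of the linearization along an execution. -/

section History

variable {P : Type u} {Task : Type v}

/-- The entry of the `push` that the place `p` is executing, until it is in the array. -/
def Config.pending (s : Config P Task) (p : P) : Option (Entry P Task) :=
  match s.pc p with
  | .pushNew k task => some ⟨p, k, task⟩
  | .pushTail _ it => s.item it
  | .pushRand _ it _ => s.item it
  | .pushLoop _ it _ _ _ => s.item it
  | .pushCas _ it _ _ _ => s.item it
  | _ => none

theorem Inv.place_of_pending {s : Config P Task} (hs : Inv s) {p : P} {e : Entry P Task}
    (h : s.pending p = some e) : e.place = p := by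
  have hp := hs.pc p
  unfold Config.pending at h
  cases hc : s.pc p <;> rw [hc] at h hp <;> simp only [Option.some.injEq, reduceCtorEq] at h
  case pushNew => exact h ▸ rfl
  case pushTail =>
    obtain ⟨task, he⟩ := hp.2.1
    rw [he] at h
    cases h
    rfl
  all_goals
    obtain ⟨task, he⟩ := hp.1.2.1
    rw [he] at h
    cases h
    rfl

theorem Inv.slots_eq_none {s : Config P Task} (hs : Inv s) {j : ℕ} :
    s.slots j = none ↔ s.array j = none := by
  unfold Config.slots
  cases h : s.array j with
  | none => simp
  | some a =>
    obtain ⟨e, he⟩ := hs.alloc j a h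
    simp [he]

/-- This turns the bound relative to `tail` into the bound relative to the first free slot that
`SeqPush` asks for. -/
theorem Inv.exists_isLeast_slots {s : Config P Task} (hs : Inv s) {pos : ℕ}
    (h : s.slots pos = none) : ∃ f, IsLeast {j | s.slots j = none} f ∧ s.tail ≤ f := by
  classical
  refine ⟨Nat.find ⟨pos, h⟩, ⟨Nat.find_spec ⟨pos, h⟩, fun j hj => Nat.find_min' _ hj⟩, ?_⟩
  rw [Nat.le_find_iff]
  exact fun j hj hn => hs.filled j hj (hs.slots_eq_none.1 hn)

theorem SeqHistory.append_singleton {A B C : ℕ → Option (Entry P Task)}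
    {L : List (PushOp P Task)} (h : SeqHistory A L B) {o : PushOp P Task}
    (ho : SeqPush B o.entry o.pos C) : SeqHistory A (L ++ [o]) C := by
  induction h with
  | nil A => exact .cons _ _ _ _ _ ho (.nil _)
  | cons A B' C' o' l ho' hl ih => exact .cons _ _ _ _ _ ho' (ih ho)

theorem SeqHistory.mem {A B : ℕ → Option (Entry P Task)} {L : List (PushOp P Task)}
    (h : SeqHistory A L B) {pos : ℕ} {e : Entry P Task} (hB : B pos = some e) :
    A pos = some e ∨ ∃ o ∈ L, o.pos = pos ∧ o.entry = e := by
  induction h with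
  | nil A => exact .inl hB
  | cons A B' C' o' l ho' hl ih =>
    rcases ih hB with h1 | ⟨o, ho, h⟩
    · rw [ho'.2.2] at h1
      by_cases hpos : pos = o'.pos
      · subst hpos
        rw [Function.update_self] at h1
        exact .inr ⟨o', by simp, rfl, Option.some.inj h1⟩
      · rw [Function.update_of_ne hpos] at h1
        exact .inl h1
    · exact .inr ⟨o, List.mem_cons_of_mem _ ho, h⟩

theorem During.succ {lab : ℕ → Label P Task} {p : P} {i n : ℕ} (h : During lab p i n)
    (hn : lab n ≠ ⟨p, .resPush⟩) : During lab p i (n + 1) := by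
  refine ⟨h.1.trans n.lt_succ_self, fun m hm hmn => ?_⟩
  rcases Nat.lt_succ_iff_lt_or_eq.1 hmn with h1 | rfl
  · exact h.2 m hm h1
  · exact hn

theorem forall₂_exists_of_mem {α β : Type*} {R : α → β → Prop} {l : List α} {l' : List β}
    (h : List.Forall₂ R l l') {a : α} (ha : a ∈ l) : ∃ b ∈ l', R a b := by
  induction h with
  | nil => simp at ha
  | cons hx _ ih =>
    rcases List.mem_cons.1 ha with rfl | ha
    · exact ⟨_, List.mem_cons_self, hx⟩
    · obtain ⟨b, hb, h⟩ := ih ha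
      exact ⟨b, List.mem_cons_of_mem _ hb, h⟩

theorem TakenAfterCAS.succ {N : ℕ} {lab : ℕ → Label P Task} {L L' : List (PushOp P Task)}
    (h : TakenAfterCAS N lab L) (hL : L ⊆ L')
    (hN : ∀ pos task, (lab N).act = .take pos task → ∃ o ∈ L, o.pos = pos ∧ o.entry.task = task ∧
      ∃ c < N, During lab o.entry.place o.call c ∧ lab c = ⟨o.entry.place, .insert pos⟩) :
    TakenAfterCAS (N + 1) lab L' := by
  intro d hd p pos task hl
  rcases Nat.lt_succ_iff_lt_or_eq.1 hd with hd | rfl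
  · obtain ⟨o, ho, h⟩ := h d hd p pos task hl
    exact ⟨o, hL ho, h⟩
  · obtain ⟨o, ho, h⟩ := hN pos task (by rw [hl])
    exact ⟨o, hL ho, h⟩

theorem LinearizedAtCAS.succ {N : ℕ} {st : ℕ → Config P Task} {lab : ℕ → Label P Task}
    {L : List (PushOp P Task)} (h : LinearizedAtCAS N st lab L)
    (hN : ∀ pos, (lab N).act ≠ .insert pos) : LinearizedAtCAS (N + 1) st lab L := by
  obtain ⟨cs, h1, h2, h3⟩ := h
  refine ⟨cs, h1, fun c => (h2 c).trans ⟨fun h => ⟨h.1.trans N.lt_succ_self, h.2⟩, ?_⟩, h3⟩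
  rintro ⟨hc, pos, hpos⟩
  rcases Nat.lt_succ_iff_lt_or_eq.1 hc with hc | rfl
  · exact ⟨hc, pos, hpos⟩
  · exact absurd hpos (hN pos)

/-- The CAS of the later member `b` comes after the CAS of `a`, hence after the invocation of `a`. A
response of `b` before that invocation would precede the CAS of `b`, which lies within the call of
`b`. -/
theorem LinearizedAtCAS.pairwise {N : ℕ} {st : ℕ → Config P Task} {lab : ℕ → Label P Task}
    {L : List (PushOp P Task)} (h : LinearizedAtCAS N st lab L) :
    L.Pairwise fun a b => ¬ ∃ j, Returns lab b.entry.place b.call j ∧ j < a.call := by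
  obtain ⟨cs, h1, -, h3⟩ := h
  induction h3 with
  | nil => exact .nil
  | @cons a c L cs hac hL ih =>
    rw [List.pairwise_cons] at h1 ⊢
    refine ⟨fun b hb => ?_, ih h1.2⟩
    rintro ⟨j, ⟨⟨hj1, -⟩, hj2⟩, hja⟩
    obtain ⟨d, hd, hbd, -⟩ := forall₂_exists_of_mem hL hb
    exact hbd.2 j hj1 (hja.trans (hac.1.1.trans (h1.1 d hd))) hj2

/-- The `push` calls that are in the array after `N` steps are `L`; the others that were invoked
are pending, and the pending call of a place `p` was invoked at time `call p`. -/
structure Tracks (N : ℕ) (st : ℕ → Config P Task) (lab : ℕ → Label P Task)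
    (call : P → ℕ) (L : List (PushOp P Task)) : Prop where
  isCall : ∀ o ∈ L, o.call < N ∧ lab o.call = ⟨o.entry.place, .invPush o.entry.k o.entry.task⟩
  nodup : (L.map PushOp.call).Nodup
  legal : SeqHistory (fun _ => none) L (st N).slots
  atCAS : LinearizedAtCAS N st lab L
  taken : TakenAfterCAS N lab L
  pending : ∀ p e, (st N).pending p = some e →
    lab (call p) = ⟨p, .invPush e.k e.task⟩ ∧ During lab p (call p) N ∧
      call p ∉ L.map PushOp.call
  invoked : ∀ i < N, ∀ p k task, lab i = ⟨p, .invPush k task⟩ → i ∉ L.map PushOp.call →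
    (∃ e, (st N).pending p = some e) ∧ i = call p

theorem Tracks.exists_insert {N : ℕ} {st : ℕ → Config P Task} {lab : ℕ → Label P Task}
    {call : P → ℕ} {L : List (PushOp P Task)} (h : Tracks N st lab call L) {pos : ℕ}
    {e : Entry P Task} (he : (st N).slots pos = some e) :
    ∃ o ∈ L, o.pos = pos ∧ o.entry = e ∧ ∃ c < N,
      During lab o.entry.place o.call c ∧ lab c = ⟨o.entry.place, .insert pos⟩ := by
  rcases h.legal.mem he with h1 | ⟨o, ho, rfl, rfl⟩
  · cases h1
  · obtain ⟨cs, -, h2, h3⟩ := h.atCAS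
    obtain ⟨c, hc, hd, hl, -⟩ := forall₂_exists_of_mem h3 ho
    exact ⟨o, ho, rfl, rfl, c, ((h2 c).1 hc).1, hd, hl⟩

/-- For completeness: an invoked call outside `L` is still pending, and a pending call has had no
response. -/
theorem Tracks.isLinearization {N : ℕ} {st : ℕ → Config P Task} {lab : ℕ → Label P Task}
    {call : P → ℕ} {L : List (PushOp P Task)} (h : Tracks N st lab call L) :
    IsLinearization N st lab L := by
  refine ⟨h.isCall, h.nodup, fun i j p k task hj hi hr => ?_, h.atCAS.pairwise, h.legal⟩
  by_contra hn
  have hn' : i ∉ L.map PushOp.call := fun hm => hn (List.mem_map.1 hm)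
  obtain ⟨⟨e, he⟩, rfl⟩ := h.invoked i (hr.1.1.trans hj) p k task hi hn'
  exact (h.pending p e he).2.1.2 j hr.1.1 hj hr.2

/-- Covers every transition other than an invocation of `push` and an insertion. The condition on
`resPush` prevents a response from closing a call that is still pending. -/
theorem Tracks.succ_of_pending_eq {N : ℕ} {st : ℕ → Config P Task} {lab : ℕ → Label P Task}
    {call : P → ℕ} {L : List (PushOp P Task)} (h : Tracks N st lab call L)
    (hins : ∀ pos, (lab N).act ≠ .insert pos) (hinv : ∀ k task, (lab N).act ≠ .invPush k task)
    (hres : (lab N).act = .resPush → (st N).pending (lab N).place = none)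
    (htake : ∀ pos task, (lab N).act = .take pos task →
      ∃ e, (st N).slots pos = some e ∧ e.task = task)
    (hp : (st (N + 1)).pending = (st N).pending) (hsl : (st (N + 1)).slots = (st N).slots) :
    Tracks (N + 1) st lab call L := by
  refine ⟨fun o ho => ⟨(h.isCall o ho).1.trans N.lt_succ_self, (h.isCall o ho).2⟩, h.nodup,
    hsl ▸ h.legal, h.atCAS.succ hins, h.taken.succ (List.Subset.refl L) fun pos task hN => ?_,
    fun p e he => ?_, fun i hi p k task hl hn => ?_⟩
  · obtain ⟨e, he, rfl⟩ := htake pos task hN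
    obtain ⟨o, ho, hpos, rfl, hc⟩ := h.exists_insert he
    exact ⟨o, ho, hpos, rfl, hc⟩
  · rw [hp] at he
    obtain ⟨h1, h2, h3⟩ := h.pending p e he
    refine ⟨h1, h2.succ fun hl => ?_, h3⟩
    have := hres (by rw [hl])
    rw [hl, he] at this
    cases this
  · rw [hp]
    rcases Nat.lt_succ_iff_lt_or_eq.1 hi with hi | rfl
    · exact h.invoked i hi p k task hl hn
    · exact absurd (congrArg Label.act hl) (hinv k task)

variable [DecidableEq P]

/-- The effect of a transition on the slots and on the pending entries. -/
def Effect (s s' : Config P Task) (p : P) : Act Task → Prop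
  | .invPush k task => s.pending p = none ∧ s'.pending = Function.update s.pending p
      (some ⟨p, k, task⟩) ∧ s'.slots = s.slots
  | .insert pos => ∃ e, s.pending p = some e ∧ s'.pending = Function.update s.pending p none ∧
      s.slots pos = none ∧ s'.slots = Function.update s.slots pos (some e) ∧
      (∃ it, s'.array pos = some it ∧ s'.item it = some e ∧ s'.tag it = (pos : ℤ)) ∧
      s.tail ≤ pos ∧ pos < s.tail + e.k
  | .resPush => s.pending p = none ∧ s'.pending = s.pending ∧ s'.slots = s.slots
  | .take pos task => (∃ e, s.slots pos = some e ∧ e.task = task) ∧ s'.pending = s.pending ∧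
      s'.slots = s.slots
  | _ => s'.pending = s.pending ∧ s'.slots = s.slots

theorem Tracks.succ_of_invPush {N : ℕ} {st : ℕ → Config P Task} {lab : ℕ → Label P Task}
    {call : P → ℕ} {L : List (PushOp P Task)} (h : Tracks N st lab call L)
    {p : P} {k : ℕ} {task : Task} (hl : lab N = ⟨p, .invPush k task⟩)
    (hnone : (st N).pending p = none)
    (hp : (st (N + 1)).pending = Function.update (st N).pending p (some ⟨p, k, task⟩))
    (hsl : (st (N + 1)).slots = (st N).slots) :
    Tracks (N + 1) st lab (Function.update call p N) L := by
  refine ⟨fun o ho => ⟨(h.isCall o ho).1.trans N.lt_succ_self, (h.isCall o ho).2⟩, h.nodup,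
    hsl ▸ h.legal, h.atCAS.succ (by simp [hl]),
    h.taken.succ (List.Subset.refl L) (by simp [hl]), fun q e he => ?_, fun i hi q k' task' hl' hn => ?_⟩
  · rw [hp] at he
    by_cases hq : q = p
    · subst hq
      simp only [Function.update_self, Option.some.injEq] at he ⊢
      subst he
      -- The new call is named by `N`, while all calls in `L` were invoked strictly earlier.
      refine ⟨hl, ⟨N.lt_succ_self, fun m h1 h2 => by omega⟩, fun hm => ?_⟩
      obtain ⟨o, ho, hoN⟩ := List.mem_map.1 hm
      exact absurd (h.isCall o ho).1 (by omega)
    · simp only [Function.update_of_ne hq] at he ⊢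
      obtain ⟨h1, h2, h3⟩ := h.pending q e he
      exact ⟨h1, h2.succ (by simp [hl]), h3⟩
  · rw [hp]
    rcases Nat.lt_succ_iff_lt_or_eq.1 hi with hi | rfl
    · obtain ⟨⟨e, he⟩, hc⟩ := h.invoked i hi q k' task' hl' hn
      have hq : q ≠ p := by
        rintro rfl
        simp [hnone] at he
      simp only [Function.update_of_ne hq]
      exact ⟨⟨e, he⟩, hc⟩
    · rw [hl] at hl'
      cases hl'
      simp

theorem Tracks.succ_of_insert {N : ℕ} {st : ℕ → Config P Task} {lab : ℕ → Label P Task}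
    {call : P → ℕ} {L : List (PushOp P Task)} (h : Tracks N st lab call L) (hs : Inv (st N))
    {p : P} {pos : ℕ} (hl : lab N = ⟨p, .insert pos⟩)
    (he : Effect (st N) (st (N + 1)) p (.insert pos)) :
    ∃ L, Tracks (N + 1) st lab call L := by
  obtain ⟨e, hpe, hp, hfree, hsl, hit, hle, hlt⟩ := he
  obtain rfl := hs.place_of_pending hpe
  obtain ⟨hc1, hc2, hc3⟩ := h.pending _ e hpe
  refine ⟨L ++ [⟨call e.place, e, pos⟩], fun o ho => ?_, ?_, ?_, ?_,
    h.taken.succ (List.subset_append_left _ _) (by simp [hl]), fun q e' he' => ?_,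
    fun i hi q k' task' hl' hn => ?_⟩
  · rcases List.mem_append.1 ho with ho | ho
    · exact ⟨(h.isCall o ho).1.trans N.lt_succ_self, (h.isCall o ho).2⟩
    · obtain rfl := List.mem_singleton.1 ho
      exact ⟨hc2.1.trans N.lt_succ_self, hc1⟩
  · rw [List.map_append, List.nodup_append]
    refine ⟨h.nodup, by simp, fun a ha b hb => ?_⟩
    simp only [List.map_cons, List.map_nil, List.mem_singleton] at hb
    rintro rfl
    exact hc3 (hb ▸ ha)
  · refine h.legal.append_singleton ⟨hfree, ?_, hsl⟩
    obtain ⟨f, hf, htf⟩ := hs.exists_isLeast_slots hfree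
    exact ⟨f, hf, hlt.trans_le (Nat.add_le_add_right htf _)⟩
  · obtain ⟨cs, h1, h2, h3⟩ := h.atCAS
    refine ⟨cs ++ [N], ?_, fun c => ?_, ?_⟩
    · rw [List.pairwise_append]
      refine ⟨h1, by simp, fun a ha b hb => ?_⟩
      obtain rfl := List.mem_singleton.1 hb
      exact ((h2 a).1 ha).1
    · rw [List.mem_append, h2, List.mem_singleton, Nat.lt_succ_iff_lt_or_eq]
      constructor
      · rintro (⟨h1, h2⟩ | rfl)
        · exact ⟨.inl h1, h2⟩
        · exact ⟨.inr rfl, pos, by rw [hl]⟩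
      · rintro ⟨h1 | rfl, h2⟩
        · exact .inl ⟨h1, h2⟩
        · exact .inr rfl
    · exact List.rel_append h3 (.cons ⟨hc2, hl, hit, hle, hlt⟩ .nil)
  · rw [hp] at he'
    have hq : q ≠ e.place := by
      rintro rfl
      simp at he'
    rw [Function.update_of_ne hq] at he'
    obtain ⟨h1, h2, h3⟩ := h.pending q e' he'
    refine ⟨h1, h2.succ (by simp [hl]), fun hm => ?_⟩
    rw [List.map_append, List.mem_append] at hm
    rcases hm with hm | hm
    · exact h3 hm
    · simp only [List.map_cons, List.map_nil, List.mem_singleton] at hm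
      -- Calls of different places have different names, since the label at the time of invocation
      -- determines the place.
      rw [hm, hc1] at h1
      exact hq (congrArg Label.place h1).symm
  · simp only [List.map_append, List.map_cons, List.map_nil, List.mem_append, List.mem_singleton,
      not_or] at hn
    rcases Nat.lt_succ_iff_lt_or_eq.1 hi with hi | rfl
    · obtain ⟨h1, h2⟩ := h.invoked i hi q k' task' hl' hn.1
      have hq : q ≠ e.place := by
        rintro rfl
        exact hn.2 h2
      rw [hp, Function.update_of_ne hq]
      exact ⟨h1, h2⟩
    · rw [hl] at hl'
      cases hl'

variable [Preorder Task] {kMax : ℕ} {test : ℕ → ℕ → Prop}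

theorem Inv.pending_of_ne {s s' : Config P Task} {l : Label P Task} (hs : Inv s)
    (h : Step kMax test s l s') {q : P} (hq : q ≠ l.place) : s'.pending q = s.pending q := by
  have hx := hs.extends h
  have hp := hs.pc q
  unfold Config.pending
  rw [hx.pc q hq]
  cases hc : s.pc q <;> rw [hc] at hp <;> try rfl
  case pushTail =>
    obtain ⟨task, he⟩ := hp.2.1
    exact (hx.item _ _ he).trans he.symm
  all_goals
    obtain ⟨task, he⟩ := hp.1.2.1
    exact (hx.item _ _ he).trans he.symm

theorem Inv.pending_eq_update {s s' : Config P Task} {l : Label P Task} (hs : Inv s)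
    (h : Step kMax test s l s') :
    s'.pending = Function.update s.pending l.place (s'.pending l.place) := by
  funext q
  by_cases hq : q = l.place
  · subst hq
    simp
  · simp [hq, hs.pending_of_ne h hq]

theorem Inv.effect {s s' : Config P Task} {l : Label P Task} (hs : Inv s)
    (h : Step kMax test s l s') : Effect s s' l.place l.act := by
  have hu := hs.pending_eq_update h
  have hp := hs.pc l.place
  have hsame : s'.pending l.place = s.pending l.place → s'.pending = s.pending := fun h => by
    rw [hu, h, Function.update_eq_self]
  cases h
  case invPush p k task hpc hk hk' =>
    refine ⟨by simp [Config.pending, hpc], hu.trans ?_, rfl⟩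
    simp [Config.pending, Config.goto]
  case pushNew p k task a v hpc hfresh =>
    -- Allocation moves the pending entry from the control state into the heap without changing it;
    -- the slots are unaffected because no slot refers to a fresh address.
    refine ⟨hsame (by simp [Config.pending, Config.goto, hpc]), funext fun j => ?_⟩
    change (s.array j).bind (Function.update s.item a _) = (s.array j).bind s.item
    cases hj : s.array j with
    | none => rfl
    | some b =>
      have : b ≠ a := by
        rintro rfl
        obtain ⟨e, he⟩ := hs.alloc j b hj
        simp [hfresh] at he
      simp [this]
  case pushCasSucc p k it t off i hpc hfree =>
    rw [hpc] at hp
    obtain ⟨⟨hk, ⟨task, he⟩, hn⟩, ⟨ht, ho, htr⟩, hi, hg⟩ := hp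
    have hmod : i % k < k := Nat.mod_lt _ hk
    refine ⟨⟨p, k, task⟩, by simp [Config.pending, hpc, he], hu.trans ?_, hs.slots_eq_none.2 hfree,
      funext fun j => ?_, ⟨it, by simp [Config.goto], he, hg⟩, ?_, ?_⟩
    · simp [Config.pending, Config.goto]
    · by_cases hj : j = t + i % k
      · subst hj
        simp [Config.slots, Config.goto, he]
      · simp [Config.slots, Config.goto, hj]
    -- Lower bound: a free slot cannot lie below `tail`. The upper bound, in the next bullet, uses
    -- that the value `t` read earlier is at most the current `tail`.
    · by_contra hlt
      exact hs.filled _ (not_le.1 hlt) hfree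
    · exact (Nat.add_lt_add_left hmod t).trans_le (Nat.add_le_add_right ht k)
  case resPush p hpc =>
    exact ⟨by simp [Config.pending, hpc], hsame (by simp [Config.pending, Config.goto, hpc]), rfl⟩
  case popCasSucc p r task hpc ht =>
    rw [hpc] at hp
    obtain ⟨ha, e, he, hk⟩ := hp
    exact ⟨⟨e, by simp [Config.slots, ha, he], hk⟩,
      hsame (by simp [Config.pending, Config.goto, hpc]), rfl⟩
  case popTakeSucc p pos it task hpc ht =>
    rw [hpc] at hp
    obtain ⟨ha, e, he, hk⟩ := hp
    exact ⟨⟨e, by simp [Config.slots, ha, he], hk⟩,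
      hsame (by simp [Config.pending, Config.goto, hpc]), rfl⟩
  all_goals exact ⟨hsame (by simp [Config.pending, Config.goto, *]), rfl⟩

theorem IsExec.exists_tracks {N : ℕ} {st : ℕ → Config P Task} {lab : ℕ → Label P Task}
    (h : IsExec kMax test N st lab) : ∃ call L, Tracks N st lab call L := by
  induction N with
  | zero =>
    -- The initial value of `call` is arbitrary: no place has a pending entry yet.
    refine ⟨fun _ => 0, [], by simp, by simp, ?_, ⟨[], by simp, by simp, .nil⟩,
      fun d hd => absurd hd (Nat.not_lt_zero d), fun p e he => ?_,
      fun i hi => absurd hi (Nat.not_lt_zero i)⟩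
    · have : (st 0).slots = fun _ => none := by
        rw [h.1]
        rfl
      rw [this]
      exact .nil _
    · simp [h.1, initial, Config.pending] at he
  | succ N ih =>
    obtain ⟨call, L, hT⟩ := ih (h.mono N.le_succ)
    have hs := (h.mono N.le_succ).inv
    have he := hs.effect (h.2 N N.lt_succ_self)
    obtain ⟨p, a, hl⟩ : ∃ p a, lab N = ⟨p, a⟩ := ⟨_, _, rfl⟩
    rw [hl] at he
    cases a
    case invPush k task => exact ⟨_, _, hT.succ_of_invPush hl he.1 he.2.1 he.2.2⟩
    case insert pos => exact ⟨call, hT.succ_of_insert hs hl he⟩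
    case resPush =>
      exact ⟨call, L, hT.succ_of_pending_eq (by simp [hl]) (by simp [hl])
        (fun _ => by rw [hl]; exact he.1)
        (by simp [hl]) he.2.1 he.2.2⟩
    case take =>
      exact ⟨call, L, hT.succ_of_pending_eq (by simp [hl]) (by simp [hl]) (by simp [hl])
        (fun pos task h => by rw [hl] at h; cases h; exact he.1) he.2.1 he.2.2⟩
    all_goals
      exact ⟨call, L, hT.succ_of_pending_eq (by simp [hl]) (by simp [hl]) (by simp [hl])
        (by simp [hl]) he.1 he.2⟩

end History

/-! ### Lock-freedom by decreasing measures. -/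

section LockFree

variable {P : Type u} {Task : Type v}

/-- The number of phases of its current or next `push` that a place has to complete. -/
def PC.phases : PC Task → ℕ
  | .pushNew _ _ => 3
  | .pushTail _ _ | .pushRand _ _ _ | .pushLoop _ _ _ _ _ | .pushCas _ _ _ _ _ => 2
  | .pushRef _ _ => 1
  | .pushRet => 0
  | _ => 4

/-- A bound for the number of steps that a place makes between the allocation of its item and its
insertion while neither the array nor the value `T` of `tail` changes. -/
def PC.retries (T : ℕ) : PC Task → ℕ
  | .pushTail k _ => 2 * k + 3
  | .pushRand k _ t => 2 * k + 2 + if t = T then 0 else 2 * k + 3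
  | .pushLoop k _ t off i => 2 * (off + k - i) + 1 + if t = T then 0 else 2 * k + 3
  | .pushCas k _ t off i => 2 * (off + k - i) + if t = T then 0 else 2 * k + 3
  | _ => 0

/-- The sequence stays constant once it has reached its minimum. `pushLockFree` uses this for three
measures in turn: phases, room left for `tail`, and retries. -/
theorem exists_forall_succ_eq {f : ℕ → ℕ} {m : ℕ} (h : ∀ n ≥ m, f (n + 1) ≤ f n) :
    ∃ m' ≥ m, ∀ n ≥ m', f (n + 1) = f n := by
  have hanti : Antitone fun n => f (m + n) := antitone_nat_of_succ_le fun n => h _ (m.le_add_right n)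
  obtain ⟨n₀, hn₀⟩ := WellFounded.has_min (wellFounded_lt (α := ℕ))
    (Set.range fun n => f (m + n)) ⟨_, 0, rfl⟩
  obtain ⟨⟨d, rfl⟩, hmin⟩ := hn₀
  refine ⟨m + d, by omega, fun n hn => le_antisymm (h n (by omega)) ?_⟩
  obtain ⟨c, rfl⟩ := Nat.exists_eq_add_of_le hn
  have h1 : f (m + (d + c)) ≤ f (m + d) := hanti (by omega)
  have h2 := not_lt.1 (hmin (f (m + (d + c + 1))) ⟨_, rfl⟩)
  simp only [← add_assoc] at h1 h2
  exact h1.trans h2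

theorem sum_le_sum_of_eq_of_ne [Fintype P] {f g : P → ℕ} {p : P} (h : ∀ q, q ≠ p → f q = g q)
    (hp : f p ≤ g p) : ∑ q, f q ≤ ∑ q, g q :=
  Finset.sum_le_sum fun q _ => by
    by_cases hq : q = p
    · exact hq ▸ hp
    · exact (h q hq).le

theorem sum_lt_sum_of_eq_of_ne [Fintype P] {f g : P → ℕ} {p : P} (h : ∀ q, q ≠ p → f q = g q)
    (hp : f p < g p) : ∑ q, f q < ∑ q, g q :=
  Finset.sum_lt_sum (fun q _ => by
    by_cases hq : q = p
    · exact hq ▸ hp.le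
    · exact (h q hq).le) ⟨p, Finset.mem_univ p, hp⟩

variable [DecidableEq P] [Preorder Task] {kMax : ℕ} {test : ℕ → ℕ → Prop}

theorem Inv.exists_step {s : Config P Task} (hs : Inv s) {p : P} (hp : (s.pc p).InPush) :
    ∃ a s', Step kMax test s ⟨p, a⟩ s' := by
  have hi := hs.pc p
  cases hc : s.pc p <;> rw [hc] at hp hi <;> try exact hp.elim
  case pushNew k task =>
    -- Only finitely many addresses are allocated, so a fresh one exists.
    obtain ⟨B, hB⟩ := hs.item_bdd
    exact ⟨_, _, .pushNew s p k task B 0 hc (hB B le_rfl)⟩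
  case pushTail k it => exact ⟨_, _, .pushTail s p k it hc⟩
  case pushRand k it t => exact ⟨_, _, .pushRand s p k it t 0 hc hi.1.1⟩
  case pushLoop k it t off i =>
    rcases lt_or_ge i (off + k) with h | h
    · exact ⟨_, _, .pushTag s p k it t off i hc h⟩
    · by_cases ht : s.tail = t
      · exact ⟨_, _, .pushTailSucc s p k it t off i hc h ht⟩
      · exact ⟨_, _, .pushTailFail s p k it t off i hc h ht⟩
  case pushCas k it t off i =>
    by_cases h : s.array (t + i % k) = none
    · exact ⟨_, _, .pushCasSucc s p k it t off i hc h⟩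
    · exact ⟨_, _, .pushCasFail s p k it t off i hc h⟩
  case pushRef pos it => exact ⟨_, _, .pushRef s p pos it hc⟩
  case pushRet => exact ⟨_, _, .resPush s p hc⟩

theorem Step.phases_le {s s' : Config P Task} {l : Label P Task} (h : Step kMax test s l s')
    (hl : l.act ≠ .resPush) : (s'.pc l.place).phases ≤ (s.pc l.place).phases := by
  cases h
  case resPush => exact absurd rfl hl
  all_goals simp [Config.goto, PC.phases, *]

/-- A step that completes no phase leaves the array unchanged; if it also leaves `tail` unchanged,
it uses up a retry if it is a step of `push`. -/
theorem Inv.stalled {s s' : Config P Task} {l : Label P Task} (hs : Inv s)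
    (h : Step kMax test s l s') (hl : l.act ≠ .resPush)
    (hph : (s'.pc l.place).phases = (s.pc l.place).phases) :
    s'.array = s.array ∧ (s'.tail = s.tail →
      (s'.pc l.place).retries s.tail ≤ (s.pc l.place).retries s.tail ∧
      ((s.pc l.place).InPush →
        (s'.pc l.place).retries s.tail < (s.pc l.place).retries s.tail)) := by
  have hp := hs.pc l.place
  cases h
  case resPush => exact absurd rfl hl
  case invPush => simp [Config.goto, PC.phases, *] at hph
  case pushNew => simp [Config.goto, PC.phases, *] at hph
  case pushCasSucc => simp [Config.goto, PC.phases, *] at hph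
  case pushRef => simp [Config.goto, PC.phases, *] at hph
  case pushTail p k it hpc => simp [Config.goto, PC.retries, hpc]
  case pushRand p k it t off hpc hoff =>
    simp [Config.goto, PC.retries, hpc]
  case pushTag p k it t off i hpc hi =>
    simp [Config.goto, PC.retries, hpc]
  case pushCasFail p k it t off i hpc hfull =>
    rw [hpc] at hp
    have := hp.2.2.1
    simp [Config.goto, PC.retries, hpc]
    omega
  -- Here `tail` grows by `k ≥ 1`, so the assumption that it is unchanged fails.
  case pushTailSucc p k it t off i hpc hi ht =>
    rw [hpc] at hp
    have := hp.1.1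
    refine ⟨rfl, fun h => ?_⟩
    simp [Config.goto, ht] at h
    omega
  -- The surcharge `2 * k + 3` of a stale `t` pays for this restart: it is the full budget of
  -- `pushTail`, namely two steps for each of `k` attempts, two to read `tail` and draw the offset,
  -- and one for the final CAS. The next read returns the current `tail`, so no second surcharge
  -- arises.
  case pushTailFail p k it t off i hpc hi ht =>
    simp [Config.goto, PC.retries, hpc, Ne.symm ht]
  all_goals simp [Config.goto, PC.retries, PC.InPush, *]

theorem pushLockFree [Finite P] : PushLockFree P Task kMax test := by
  have := Fintype.ofFinite P
  refine ⟨fun N st lab h p hp => h.inv.exists_step hp, fun st lab hex hpush m => ?_⟩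
  by_contra! hres
  have hinv n := (hex n).inv
  have hstep n := (hex (n + 1)).2 n n.lt_succ_self
  have hpc n q (hq : q ≠ (lab n).place) := ((hinv n).extends (hstep n)).pc q hq
  obtain ⟨m₁, hm₁, hph⟩ := exists_forall_succ_eq (f := fun n => ∑ q, ((st n).pc q).phases)
    (m := m) fun n hn => sum_le_sum_of_eq_of_ne (fun q hq => by rw [hpc n q hq])
      ((hstep n).phases_le (hres n hn))
  -- Only the acting place can change its phase count, so a constant sum means that this place
  -- completes no phase either.
  have hstall n (hn : m₁ ≤ n) := (hinv n).stalled (hstep n) (hres n (hm₁.trans hn)) <|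
    le_antisymm ((hstep n).phases_le (hres n (hm₁.trans hn))) <| not_lt.1 fun hlt =>
      (sum_lt_sum_of_eq_of_ne (fun q hq => by rw [hpc n q hq]) hlt).ne (hph n hn)
  have harr n (hn : m₁ ≤ n) : (st n).array = (st m₁).array := by
    induction n, hn using Nat.le_induction with
    | base => rfl
    | succ n hn ih => exact (hstall n hn).1.trans ih
  obtain ⟨B, hB⟩ := (hinv m₁).array_bdd
  -- The slot `B` stays empty forever, and `tail` cannot pass an empty slot.
  have htail n (hn : m₁ ≤ n) : (st n).tail ≤ B := not_lt.1 fun hlt =>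
    (hinv n).filled B hlt (by rw [harr n hn, hB B le_rfl])
  obtain ⟨m₂, hm₂, htl⟩ := exists_forall_succ_eq (f := fun n => B - (st n).tail) (m := m₁)
    fun n _ => Nat.sub_le_sub_left ((hinv n).extends (hstep n)).tail B
  -- The truncated difference `B - tail` determines `tail` because `tail ≤ B` at both times.
  have htl' n (hn : m₂ ≤ n) : (st (n + 1)).tail = (st n).tail := by
    have h1 := htl n hn
    have h2 := htail n (hm₂.trans hn)
    have h3 := htail (n + 1) (by omega)
    omega
  have hT n (hn : m₂ ≤ n) : (st n).tail = (st m₂).tail := by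
    induction n, hn using Nat.le_induction with
    | base => rfl
    | succ n hn ih => exact (htl' n hn).trans ih
  have hret n (hn : m₂ ≤ n) := hT n hn ▸ (hstall n (hm₂.trans hn)).2 (htl' n hn)
  obtain ⟨m₃, hm₃, hsum⟩ := exists_forall_succ_eq
    (f := fun n => ∑ q, ((st n).pc q).retries (st m₂).tail) (m := m₂)
    fun n hn => sum_le_sum_of_eq_of_ne (fun q hq => by rw [hpc n q hq]) (hret n hn).1
  obtain ⟨n, hn, hin⟩ := hpush m₃
  exact (sum_lt_sum_of_eq_of_ne (fun q hq => by rw [hpc n q hq])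
    ((hret n (hm₃.trans hn)).2 hin)).ne (hsum n hn)

end LockFree

end KPriority

theorem theorem1 {P : Type*} {Task : Type*} [Finite P] [DecidableEq P] [Preorder Task]
    (kMax : ℕ) (test : ℕ → ℕ → Prop) :
    KPriority.PushLockFree P Task kMax test ∧
    ∀ (N : ℕ) (st : ℕ → KPriority.Config P Task) (lab : ℕ → KPriority.Label P Task),
      KPriority.IsExec kMax test N st lab →
      ∃ L : List (KPriority.PushOp P Task),
        KPriority.IsLinearization N st lab L ∧
        KPriority.LinearizedAtCAS N st lab L ∧
        KPriority.TakenAfterCAS N lab L := by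
  refine ⟨KPriority.pushLockFree, fun N st lab h => ?_⟩
  obtain ⟨call, L, hL⟩ := h.exists_tracks
  exact ⟨L, hL.isLinearization, hL.atCAS, hL.taken⟩
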